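/- Let formulas be built from a set of propositional variables by binary connectives $\wedge,\vee$, a unary connective $-$ and constants $\top,\bot$. A sequent $\Gamma\vartriangleright\Delta$ is a pair of finite multisets of formulas; a rule consists of a (possibly infinite) set of premise sequents and one conclusion sequent; a Gentzen calculus is a set of rules. A proof in a calculus from a set $S$ of sequents is a well-founded tree of sequents in which every node is either a member of $S$ or is obtained from its immediate predecessors by a substitution instance of a rule; a sequent is provable if it has a proof from $S=\emptyset$. Let $\mathcal{G}_{\mathcal{B}}$ be the calculus with the following rules (for all formulas $\varphi,\psi$ and finite multisets $\Gamma,\Delta$), where a double arrow means that the rule is included together with its inverse(s), one for each sequent on the left-hand side: - $\Gamma\vartriangleright\Delta,\varphi$ and $\Gamma\vartriangleright\Delta,\psi$ $\;\Leftrightarrow\;$ $\Gamma\vartriangleright\Delta,\varphi\wedge\psi$; $\quad\varphi,\psi,\Gamma\vartriangleright\Delta$ $\;\Leftrightarrow\;$ $\varphi\wedge\psi,\Gamma\vartriangleright\Delta$; - $\varphi,\Gamma\vartriangleright\Delta$ and $\psi,\Gamma\vartriangleright\Delta$ $\;\Leftrightarrow\;$ $\varphi\vee\psi,\Gamma\vartriangleright\Delta$;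 $\quad\Gamma\vartriangleright\Delta,\varphi,\psi$ $\;\Leftrightarrow\;$ $\Gamma\vartriangleright\Delta,\varphi\vee\psi$; - $\varphi,\Gamma\vartriangleright\Delta$ $\;\Leftrightarrow\;$ $\Gamma\vartriangleright\Delta,-\varphi$; $\quad\Gamma\vartriangleright\Delta,\varphi$ $\;\Leftrightarrow\;$ $-\varphi,\Gamma\vartriangleright\Delta$; - the axioms $\emptyset\vartriangleright\top$ and $\bot\vartriangleright\emptyset$; from $\top,\Gamma\vartriangleright\Delta$ infer $\Gamma\vartriangleright\Delta$; from $\Gamma\vartriangleright\Delta,\bot$ infer $\Gamma\vartriangleright\Delta$; - Weakening (from $\Gamma\vartriangleright\Delta$ infer $\varphi,\Gamma\vartriangleright\Delta$, and infer $\Gamma\vartriangleright\Delta,\varphi$) and Contraction (from $\varphi,\varphi,\Gamma\vartriangleright\Delta$ infer $\varphi,\Gamma\vartriangleright\Delta$; from $\Gamma\vartriangleright\Delta,\varphi,\varphi$ infer $\Gamma\vartriangleright\Delta,\varphi$). A rule is structural if all formulas occurring in its premises and conclusion are propositional variables. A super-Belnap calculus is an extension of $\mathcal{G}_{\mathcal{B}}$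 by an arbitrary set of (possibly infinitary) structural rules. Theorem. Cut is admissible in every super-Belnap calculus: if $\mathcal{G}$ is a super-Belnap calculus, then every sequent provable in the calculus obtained from $\mathcal{G}$ by adding the Cut rule (from $\Gamma\vartriangleright\Delta,\varphi$ and $\varphi,\Gamma'\vartriangleright\Delta'$ infer $\Gamma,\Gamma'\vartriangleright\Delta,\Delta'$, for all formulas $\varphi$ and finite multisets $\Gamma,\Gamma',\Delta,\Delta'$) is already provable in $\mathcal{G}$. -/

import Mathlib

universe u

/-- Propositional formulas over the variables `V` in the signature of the Dunn-Belnap logic: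
conjunction, disjunction, De Morgan negation and the two truth constants. -/
inductive Formula (V : Type u) : Type u
  | var : V → Formula V
  | top : Formula V
  | bot : Formula V
  | neg : Formula V → Formula V
  | and : Formula V → Formula V → Formula V
  | or : Formula V → Formula V → Formula V

/-- The homomorphic extension of a substitution `σ` to all formulas. -/
def Formula.subst {V : Type u} (σ : V → Formula V) : Formula V → Formula V
  | .var p => σ p
  | .top => .top
  | .bot => .bot
  | .neg φ => .neg (φ.subst σ)
  | .and φ ψ => .and (φ.subst σ) (ψ.subst σ)
  | .or φ ψ => .or (φ.subst σ) (ψ.subst σ)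

/-- A sequent is a pair of finite multisets of formulas. -/
structure Sequent (V : Type u) : Type u where
  ant : Multiset (Formula V)
  suc : Multiset (Formula V)

/-- The sequent with antecedent `Γ` and succedent `Δ`. -/
infix:45 " ▷ " => Sequent.mk

/-- Application of a substitution to a sequent. -/
def Sequent.subst {V : Type u} (σ : V → Formula V) (s : Sequent V) : Sequent V :=
  s.ant.map (Formula.subst σ) ▷ s.suc.map (Formula.subst σ)

/-- A sequent is atomic if all its formulas are variables. -/
def Sequent.IsAtomic {V : Type u} (s : Sequent V) : Prop :=
  (∀ φ ∈ s.ant, ∃ p : V, φ = .var p) ∧ (∀ φ ∈ s.suc, ∃ p : V, φ = .var p)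

/-- A Gentzen rule: a (possibly infinite) set of premises and one conclusion. -/
structure GentzenRule (V : Type u) : Type u where
  premises : Set (Sequent V)
  conclusion : Sequent V

/-- A rule is structural if no connective and no truth constant occurs in it. -/
def GentzenRule.IsStructural {V : Type u} (r : GentzenRule V) : Prop :=
  (∀ t ∈ r.premises, t.IsAtomic) ∧ r.conclusion.IsAtomic

/-- A Gentzen calculus is a set of rules. -/
abbrev GentzenCalculus (V : Type u) : Type u := Set (GentzenRule V)

/-- `Derivable C S s`: there is a proof of `s` from the set of sequents `S` in `C`, that is, a
well-founded tree whose leaves may be members of `S` and whose other steps are substitution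
instances of rules of `C`. -/
inductive Derivable {V : Type u} (C : GentzenCalculus V) (S : Set (Sequent V)) :
    Sequent V → Prop
  | prem (s : Sequent V) (hs : s ∈ S) : Derivable C S s
  | step (r : GentzenRule V) (hr : r ∈ C) (σ : V → Formula V)
      (h : ∀ t ∈ r.premises, Derivable C S (t.subst σ)) : Derivable C S (r.conclusion.subst σ)

/-- A sequent is provable in `C` if it is derivable from the empty set of sequents. -/
def Provable {V : Type u} (C : GentzenCalculus V) (s : Sequent V) : Prop :=
  Derivable C ∅ s

/-- The rules of the Gentzen calculus for the Dunn-Belnap logic: the introduction and elimination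
rules for the connectives and constants, and the common structural rules. -/
inductive IsBelnapRule {V : Type u} : GentzenRule V → Prop
  | andR_intro (Γ Δ : Multiset (Formula V)) (φ ψ : Formula V) :
      IsBelnapRule ⟨{Γ ▷ φ ::ₘ Δ, Γ ▷ ψ ::ₘ Δ}, Γ ▷ φ.and ψ ::ₘ Δ⟩
  | andR_elim_left (Γ Δ : Multiset (Formula V)) (φ ψ : Formula V) :
      IsBelnapRule ⟨{Γ ▷ φ.and ψ ::ₘ Δ}, Γ ▷ φ ::ₘ Δ⟩
  | andR_elim_right (Γ Δ : Multiset (Formula V)) (φ ψ : Formula V) :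
      IsBelnapRule ⟨{Γ ▷ φ.and ψ ::ₘ Δ}, Γ ▷ ψ ::ₘ Δ⟩
  | andL_intro (Γ Δ : Multiset (Formula V)) (φ ψ : Formula V) :
      IsBelnapRule ⟨{φ ::ₘ ψ ::ₘ Γ ▷ Δ}, φ.and ψ ::ₘ Γ ▷ Δ⟩
  | andL_elim (Γ Δ : Multiset (Formula V)) (φ ψ : Formula V) :
      IsBelnapRule ⟨{φ.and ψ ::ₘ Γ ▷ Δ}, φ ::ₘ ψ ::ₘ Γ ▷ Δ⟩
  | orL_intro (Γ Δ : Multiset (Formula V)) (φ ψ : Formula V) :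
      IsBelnapRule ⟨{φ ::ₘ Γ ▷ Δ, ψ ::ₘ Γ ▷ Δ}, φ.or ψ ::ₘ Γ ▷ Δ⟩
  | orL_elim_left (Γ Δ : Multiset (Formula V)) (φ ψ : Formula V) :
      IsBelnapRule ⟨{φ.or ψ ::ₘ Γ ▷ Δ}, φ ::ₘ Γ ▷ Δ⟩
  | orL_elim_right (Γ Δ : Multiset (Formula V)) (φ ψ : Formula V) :
      IsBelnapRule ⟨{φ.or ψ ::ₘ Γ ▷ Δ}, ψ ::ₘ Γ ▷ Δ⟩
  | orR_intro (Γ Δ : Multiset (Formula V)) (φ ψ : Formula V) :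
      IsBelnapRule ⟨{Γ ▷ φ ::ₘ ψ ::ₘ Δ}, Γ ▷ φ.or ψ ::ₘ Δ⟩
  | orR_elim (Γ Δ : Multiset (Formula V)) (φ ψ : Formula V) :
      IsBelnapRule ⟨{Γ ▷ φ.or ψ ::ₘ Δ}, Γ ▷ φ ::ₘ ψ ::ₘ Δ⟩
  | negR_intro (Γ Δ : Multiset (Formula V)) (φ : Formula V) :
      IsBelnapRule ⟨{φ ::ₘ Γ ▷ Δ}, Γ ▷ φ.neg ::ₘ Δ⟩
  | negR_elim (Γ Δ : Multiset (Formula V)) (φ : Formula V) :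
      IsBelnapRule ⟨{Γ ▷ φ.neg ::ₘ Δ}, φ ::ₘ Γ ▷ Δ⟩
  | negL_intro (Γ Δ : Multiset (Formula V)) (φ : Formula V) :
      IsBelnapRule ⟨{Γ ▷ φ ::ₘ Δ}, φ.neg ::ₘ Γ ▷ Δ⟩
  | negL_elim (Γ Δ : Multiset (Formula V)) (φ : Formula V) :
      IsBelnapRule ⟨{φ.neg ::ₘ Γ ▷ Δ}, Γ ▷ φ ::ₘ Δ⟩
  | topR_intro : IsBelnapRule ⟨∅, 0 ▷ {.top}⟩
  | topL_elim (Γ Δ : Multiset (Formula V)) :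
      IsBelnapRule ⟨{.top ::ₘ Γ ▷ Δ}, Γ ▷ Δ⟩
  | botL_intro : IsBelnapRule ⟨∅, {.bot} ▷ 0⟩
  | botR_elim (Γ Δ : Multiset (Formula V)) :
      IsBelnapRule ⟨{Γ ▷ .bot ::ₘ Δ}, Γ ▷ Δ⟩
  | weakL (Γ Δ : Multiset (Formula V)) (φ : Formula V) :
      IsBelnapRule ⟨{Γ ▷ Δ}, φ ::ₘ Γ ▷ Δ⟩
  | weakR (Γ Δ : Multiset (Formula V)) (φ : Formula V) :
      IsBelnapRule ⟨{Γ ▷ Δ}, Γ ▷ φ ::ₘ Δ⟩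
  | contrL (Γ Δ : Multiset (Formula V)) (φ : Formula V) :
      IsBelnapRule ⟨{φ ::ₘ φ ::ₘ Γ ▷ Δ}, φ ::ₘ Γ ▷ Δ⟩
  | contrR (Γ Δ : Multiset (Formula V)) (φ : Formula V) :
      IsBelnapRule ⟨{Γ ▷ φ ::ₘ φ ::ₘ Δ}, Γ ▷ φ ::ₘ Δ⟩

/-- The Gentzen calculus for the Dunn-Belnap logic. -/
def belnapCalculus (V : Type u) : GentzenCalculus V := {r | IsBelnapRule r}

/-- A super-Belnap calculus is an extension of the calculus for the Dunn-Belnap logic by a set of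
(not necessarily finitary) structural rules. -/
def IsSuperBelnapCalculus {V : Type u} (C : GentzenCalculus V) : Prop :=
  ∃ R : Set (GentzenRule V), (∀ r ∈ R, r.IsStructural) ∧ C = belnapCalculus V ∪ R

/-- The Cut rule, as the set of all its instances. -/
def cutRule (V : Type u) : Set (GentzenRule V) :=
  {r | ∃ (Γ Γ' Δ Δ' : Multiset (Formula V)) (φ : Formula V),
    r = ⟨{Γ ▷ φ ::ₘ Δ, φ ::ₘ Γ' ▷ Δ'}, Γ + Γ' ▷ Δ + Δ'⟩}

/-- A set of rules `R` (such as the instances of a rule schema) is admissible in `C` if adding `R`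
to `C` does not yield any new provable sequents. -/
def IsAdmissible {V : Type u} (R : Set (GentzenRule V)) (C : GentzenCalculus V) : Prop :=
  ∀ s : Sequent V, Provable (C ∪ R) s → Provable C s

/-! ### Substitution and four-valued semantics of formulas -/

namespace Formula

variable {V : Type u}

/-! The provable sequents of any extension are controlled by two kinds of valuation: the one giving
no variable a truth value, and the classical ones. If both premises of a cut hold under the first,
so does the conclusion (`Holds.cut`), and sequents holding there are provable by introduction rules
and weakening (`of_holds`).

Otherwise some premise fails there. Substituting `χ` for all its variables, stripping its formulas
by elimination rules and contracting the surviving copies of `χ` gives `χ ▷ χ`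
(`identity_of_not_holds`). With identity, every classically valid sequent is provable
(`of_isClassicallyValid`). If both premises are classically valid, so is the conclusion; if one is
not, a refuting valuation, read as a substitution of constants, reduces it to the empty sequent, and
weakening proves everything (`of_not_isClassicallyValid`). -/

@[simp]
theorem subst_var (φ : Formula V) : φ.subst .var = φ := by
  induction φ <;> simp_all [subst]

theorem subst_subst (σ τ : V → Formula V) (φ : Formula V) :
    (φ.subst σ).subst τ = φ.subst fun p => (σ p).subst τ := by
  induction φ <;> simp_all [subst]

/-- `Supports v true φ` says that `φ` is (at least) true, and `Supports v false φ` that it is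
(at least) false, under the four-valued valuation `v`. -/
def Supports (v : Bool → V → Prop) : Bool → Formula V → Prop
  | b, .var p => v b p
  | b, .top => b = true
  | b, .bot => b = false
  | b, .neg φ => φ.Supports v (!b)
  | true, .and φ ψ => φ.Supports v true ∧ ψ.Supports v true
  | false, .and φ ψ => φ.Supports v false ∨ ψ.Supports v false
  | true, .or φ ψ => φ.Supports v true ∨ ψ.Supports v true
  | false, .or φ ψ => φ.Supports v false ∧ ψ.Supports v false

theorem not_supports_both {v : Bool → V → Prop} (hv : ∀ p, ¬(v true p ∧ v false p))
    (φ : Formula V) : ¬(φ.Supports v true ∧ φ.Supports v false) := by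
  induction φ with
  | var p => exact hv p
  | top => simp [Supports]
  | bot => simp [Supports]
  | neg φ ih => simp only [Supports, Bool.not_true, Bool.not_false]; tauto
  | and φ ψ ihφ ihψ => simp only [Supports]; tauto
  | or φ ψ ihφ ihψ => simp only [Supports]; tauto

/-- The number of symbols of a formula. -/
def size : Formula V → ℕ
  | .var _ => 1
  | .top => 1
  | .bot => 1
  | .neg φ => φ.size + 1
  | .and φ ψ => φ.size + ψ.size + 1
  | .or φ ψ => φ.size + ψ.size + 1

theorem size_pos (φ : Formula V) : 0 < φ.size := by
  cases φ <;> simp [size]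

/-- The four-valued valuation given by a two-valued one. -/
def classicalValuation (w : V → Prop) : Bool → V → Prop
  | true, p => w p
  | false, p => ¬w p

end Formula

/-! ### Validity of sequents and its preservation under cut -/

namespace Sequent

variable {V : Type u}

@[simp]
theorem subst_var (s : Sequent V) : s.subst .var = s := by
  simp [subst]

theorem subst_subst (σ τ : V → Formula V) (s : Sequent V) :
    (s.subst σ).subst τ = s.subst fun p => (σ p).subst τ := by
  simp [subst, Formula.subst_subst]

/-- A sequent holds under a four-valued valuation if some formula of the antecedent is false or
some formula of the succedent is true. -/
def Holds (v : Bool → V → Prop) (s : Sequent V) : Prop :=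
  (∃ φ ∈ s.ant, φ.Supports v false) ∨ ∃ φ ∈ s.suc, φ.Supports v true

theorem holds_cons_left {v : Bool → V → Prop} {Γ Δ : Multiset (Formula V)} {φ : Formula V} :
    (φ ::ₘ Γ ▷ Δ).Holds v ↔ φ.Supports v false ∨ (Γ ▷ Δ).Holds v := by
  simp [Holds, or_assoc]

theorem holds_cons_right {v : Bool → V → Prop} {Γ Δ : Multiset (Formula V)} {φ : Formula V} :
    (Γ ▷ φ ::ₘ Δ).Holds v ↔ φ.Supports v true ∨ (Γ ▷ Δ).Holds v := by
  simp [Holds, or_left_comm]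

theorem holds_add {v : Bool → V → Prop} {Γ Γ' Δ Δ' : Multiset (Formula V)} :
    (Γ + Γ' ▷ Δ + Δ').Holds v ↔ (Γ ▷ Δ).Holds v ∨ (Γ' ▷ Δ').Holds v := by
  simp only [Holds, Multiset.mem_add, or_and_right, exists_or]
  exact or_or_or_comm

/-- The cut formula cannot be both true and false, so at least one premise holds because of its
context. -/
theorem Holds.cut {v : Bool → V → Prop} (hv : ∀ p, ¬(v true p ∧ v false p))
    {Γ Γ' Δ Δ' : Multiset (Formula V)} {φ : Formula V}
    (h : (Γ ▷ φ ::ₘ Δ).Holds v) (h' : (φ ::ₘ Γ' ▷ Δ').Holds v) :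
    (Γ + Γ' ▷ Δ + Δ').Holds v := by
  have := φ.not_supports_both hv
  rw [holds_cons_right] at h
  rw [holds_cons_left] at h'
  rw [holds_add]
  tauto

/-- A sequent is classically valid if it holds under all two-valued valuations. -/
def IsClassicallyValid (s : Sequent V) : Prop :=
  ∀ w, s.Holds (Formula.classicalValuation w)

theorem IsClassicallyValid.cut {Γ Γ' Δ Δ' : Multiset (Formula V)} {φ : Formula V}
    (h : (Γ ▷ φ ::ₘ Δ).IsClassicallyValid) (h' : (φ ::ₘ Γ' ▷ Δ').IsClassicallyValid) :
    (Γ + Γ' ▷ Δ + Δ').IsClassicallyValid :=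
  fun w => (h w).cut (by simp [Formula.classicalValuation]) (h' w)

end Sequent

/-! ### Provability by substitution, weakening and introduction -/

namespace Provable

variable {V : Type u} {C : GentzenCalculus V} {Γ Δ : Multiset (Formula V)}

theorem subst {s : Sequent V} (h : Provable C s) (τ : V → Formula V) :
    Provable C (s.subst τ) := by
  induction h with
  | prem s hs => exact hs.elim
  | step r hr σ _ ih =>
    rw [Sequent.subst_subst]
    refine .step r hr _ fun t ht => ?_
    rw [← Sequent.subst_subst]
    exact ih t ht

/-- The Belnap rules are given with arbitrary formulas, so the identity substitution suffices. -/
theorem of_isBelnapRule (hC : belnapCalculus V ⊆ C) {r : GentzenRule V} (hr : IsBelnapRule r)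
    (h : ∀ t ∈ r.premises, Provable C t) : Provable C r.conclusion := by
  rw [← r.conclusion.subst_var]
  exact .step r (hC hr) _ fun t ht => by rw [t.subst_var]; exact h t ht

theorem of_unary (hC : belnapCalculus V ⊆ C) {s t : Sequent V} (hr : IsBelnapRule ⟨{s}, t⟩)
    (h : Provable C s) : Provable C t :=
  of_isBelnapRule hC hr (by simpa using h)

theorem of_binary (hC : belnapCalculus V ⊆ C) {s s' t : Sequent V}
    (hr : IsBelnapRule ⟨{s, s'}, t⟩) (h : Provable C s) (h' : Provable C s') : Provable C t :=
  of_isBelnapRule hC hr (by simpa using ⟨h, h'⟩)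

theorem weaken_left (hC : belnapCalculus V ⊆ C) (h : Provable C (Γ ▷ Δ))
    (Γ' : Multiset (Formula V)) : Provable C (Γ' + Γ ▷ Δ) := by
  induction Γ' using Multiset.induction_on with
  | empty => simpa using h
  | cons φ Γ' ih => rw [Multiset.cons_add]; exact of_unary hC (.weakL _ _ _) ih

theorem weaken_right (hC : belnapCalculus V ⊆ C) (h : Provable C (Γ ▷ Δ))
    (Δ' : Multiset (Formula V)) : Provable C (Γ ▷ Δ' + Δ) := by
  induction Δ' using Multiset.induction_on with
  | empty => simpa using h
  | cons φ Δ' ih => rw [Multiset.cons_add]; exact of_unary hC (.weakR _ _ _) ih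

theorem weaken (hC : belnapCalculus V ⊆ C) {Γ' Δ' : Multiset (Formula V)} (hΓ : Γ ≤ Γ')
    (hΔ : Δ ≤ Δ') (h : Provable C (Γ ▷ Δ)) : Provable C (Γ' ▷ Δ') := by
  obtain ⟨Γ₁, rfl⟩ := exists_add_of_le hΓ
  obtain ⟨Δ₁, rfl⟩ := exists_add_of_le hΔ
  rw [add_comm Γ, add_comm Δ]
  exact weaken_right hC (weaken_left hC h _) _

/-- Formulas that are true (false) when all variables lack a truth value are provable
(refutable). -/
theorem of_supports (hC : belnapCalculus V ⊆ C) (φ : Formula V) :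
    (φ.Supports (fun _ _ => False) true → ∀ Γ Δ, Provable C (Γ ▷ φ ::ₘ Δ)) ∧
    (φ.Supports (fun _ _ => False) false → ∀ Γ Δ, Provable C (φ ::ₘ Γ ▷ Δ)) := by
  induction φ with
  | var p => simp [Formula.Supports]
  | top =>
    refine ⟨fun _ Γ Δ => ?_, by simp [Formula.Supports]⟩
    exact weaken hC (by simp) (by simp) (of_isBelnapRule hC .topR_intro (by simp))
  | bot =>
    refine ⟨by simp [Formula.Supports], fun _ Γ Δ => ?_⟩
    exact weaken hC (by simp) (by simp) (of_isBelnapRule hC .botL_intro (by simp))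
  | neg φ ih =>
    exact ⟨fun h Γ Δ => of_unary hC (.negR_intro _ _ _) (ih.2 h _ _),
      fun h Γ Δ => of_unary hC (.negL_intro _ _ _) (ih.1 h _ _)⟩
  | and φ ψ ihφ ihψ =>
    refine ⟨fun h Γ Δ => of_binary hC (.andR_intro _ _ _ _) (ihφ.1 h.1 _ _) (ihψ.1 h.2 _ _),
      fun h Γ Δ => of_unary hC (.andL_intro _ _ _ _) ?_⟩
    rcases h with h | h
    · exact ihφ.2 h _ _
    · rw [Multiset.cons_swap]; exact ihψ.2 h _ _
  | or φ ψ ihφ ihψ =>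
    refine ⟨fun h Γ Δ => of_unary hC (.orR_intro _ _ _ _) ?_,
      fun h Γ Δ => of_binary hC (.orL_intro _ _ _ _) (ihφ.2 h.1 _ _) (ihψ.2 h.2 _ _)⟩
    rcases h with h | h
    · exact ihφ.1 h _ _
    · rw [Multiset.cons_swap]; exact ihψ.1 h _ _

theorem of_holds (hC : belnapCalculus V ⊆ C) {s : Sequent V}
    (h : s.Holds fun _ _ => False) : Provable C s := by
  obtain ⟨Γ, Δ⟩ := s
  rcases h with ⟨φ, hφ, h⟩ | ⟨φ, hφ, h⟩
  · obtain ⟨Γ, rfl⟩ := Multiset.exists_cons_of_mem hφ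
    exact (of_supports hC φ).2 h _ _
  · obtain ⟨Δ, rfl⟩ := Multiset.exists_cons_of_mem hφ
    exact (of_supports hC φ).1 h _ _

/-! ### Stripping formulas by elimination rules -/

/-- If, in contexts above `Γ₀ ▷ Δ₀`, substituted variables can be removed from the antecedent
unless they are false and from the succedent unless they are true, then so can substituted
formulas. -/
theorem remove (hC : belnapCalculus V ⊆ C) {v : Bool → V → Prop} {σ : V → Formula V}
    {Γ₀ Δ₀ : Multiset (Formula V)}
    (hL : ∀ p, ¬v false p → ∀ Γ Δ, Γ₀ ≤ Γ → Δ₀ ≤ Δ →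
      Provable C (σ p ::ₘ Γ ▷ Δ) → Provable C (Γ ▷ Δ))
    (hR : ∀ p, ¬v true p → ∀ Γ Δ, Γ₀ ≤ Γ → Δ₀ ≤ Δ →
      Provable C (Γ ▷ σ p ::ₘ Δ) → Provable C (Γ ▷ Δ)) (φ : Formula V) :
    (¬φ.Supports v false → ∀ Γ Δ, Γ₀ ≤ Γ → Δ₀ ≤ Δ →
      Provable C (φ.subst σ ::ₘ Γ ▷ Δ) → Provable C (Γ ▷ Δ)) ∧
    (¬φ.Supports v true → ∀ Γ Δ, Γ₀ ≤ Γ → Δ₀ ≤ Δ →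
      Provable C (Γ ▷ φ.subst σ ::ₘ Δ) → Provable C (Γ ▷ Δ)) := by
  induction φ with
  | var p => exact ⟨hL p, hR p⟩
  | top =>
    exact ⟨fun _ Γ Δ _ _ h => of_unary hC (.topL_elim _ _) h, by simp [Formula.Supports]⟩
  | bot =>
    exact ⟨by simp [Formula.Supports], fun _ Γ Δ _ _ h => of_unary hC (.botR_elim _ _) h⟩
  | neg φ ih =>
    exact ⟨fun hn Γ Δ hΓ hΔ h => ih.2 hn Γ Δ hΓ hΔ (of_unary hC (.negL_elim _ _ _) h),
      fun hn Γ Δ hΓ hΔ h => ih.1 hn Γ Δ hΓ hΔ (of_unary hC (.negR_elim _ _ _) h)⟩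
  | and φ ψ ihφ ihψ =>
    simp only [Formula.Supports, not_or, not_and_or]
    refine ⟨fun hn Γ Δ hΓ hΔ h => ?_, fun hn Γ Δ hΓ hΔ h => ?_⟩
    -- Here `φ` is removed while `ψ` is still in the context, which is why contexts range over
    -- everything above `Γ₀ ▷ Δ₀`.
    · exact ihψ.1 hn.2 Γ Δ hΓ hΔ <| ihφ.1 hn.1 _ Δ (hΓ.trans (Multiset.le_cons_self _ _)) hΔ <|
        of_unary hC (.andL_elim _ _ _ _) h
    · rcases hn with hn | hn
      · exact ihφ.2 hn Γ Δ hΓ hΔ (of_unary hC (.andR_elim_left _ _ _ _) h)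
      · exact ihψ.2 hn Γ Δ hΓ hΔ (of_unary hC (.andR_elim_right _ _ _ _) h)
  | or φ ψ ihφ ihψ =>
    simp only [Formula.Supports, not_or, not_and_or]
    refine ⟨fun hn Γ Δ hΓ hΔ h => ?_, fun hn Γ Δ hΓ hΔ h => ?_⟩
    · rcases hn with hn | hn
      · exact ihφ.1 hn Γ Δ hΓ hΔ (of_unary hC (.orL_elim_left _ _ _ _) h)
      · exact ihψ.1 hn Γ Δ hΓ hΔ (of_unary hC (.orL_elim_right _ _ _ _) h)
    · exact ihψ.2 hn.2 Γ Δ hΓ hΔ <| ihφ.2 hn.1 Γ _ hΓ (hΔ.trans (Multiset.le_cons_self _ _)) <|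
        of_unary hC (.orR_elim _ _ _ _) h

theorem of_not_holds (hC : belnapCalculus V ⊆ C) {v : Bool → V → Prop} {σ : V → Formula V}
    {Γ₀ Δ₀ : Multiset (Formula V)}
    (hL : ∀ p, ¬v false p → ∀ Γ Δ, Γ₀ ≤ Γ → Δ₀ ≤ Δ →
      Provable C (σ p ::ₘ Γ ▷ Δ) → Provable C (Γ ▷ Δ))
    (hR : ∀ p, ¬v true p → ∀ Γ Δ, Γ₀ ≤ Γ → Δ₀ ≤ Δ →
      Provable C (Γ ▷ σ p ::ₘ Δ) → Provable C (Γ ▷ Δ))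
    {s : Sequent V} (hs : Provable C s) (hn : ¬s.Holds v) : Provable C (Γ₀ ▷ Δ₀) := by
  obtain ⟨Γ, Δ⟩ := s
  simp only [Sequent.Holds, not_or, not_exists, not_and] at hn
  obtain ⟨hnΓ, hnΔ⟩ := hn
  -- Padding by `Γ₀ ▷ Δ₀` keeps every later context above it while the substituted formulas are
  -- removed one by one.
  have h : Provable C (Γ.map (Formula.subst σ) + Γ₀ ▷ Δ.map (Formula.subst σ) + Δ₀) :=
    weaken hC (by simp) (by simp) (hs.subst σ)
  clear hs
  induction Γ using Multiset.induction_on with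
  | empty =>
    induction Δ using Multiset.induction_on with
    | empty => simpa using h
    | cons φ Δ ih =>
      rw [Multiset.map_cons, Multiset.cons_add] at h
      exact ih (fun ψ hψ => hnΔ ψ (Multiset.mem_cons_of_mem hψ))
        ((remove hC hL hR φ).2 (hnΔ φ (Multiset.mem_cons_self _ _)) _ _ (by simp) (by simp) h)
  | cons φ Γ ih =>
    rw [Multiset.map_cons, Multiset.cons_add] at h
    exact ih (fun ψ hψ => hnΓ ψ (Multiset.mem_cons_of_mem hψ))
      ((remove hC hL hR φ).1 (hnΓ φ (Multiset.mem_cons_self _ _)) _ _ (by simp) (by simp) h)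

/-- A provable sequent that fails when all variables lack a truth value yields identity. -/
theorem identity_of_not_holds (hC : belnapCalculus V ⊆ C) {s : Sequent V} (hs : Provable C s)
    (hn : ¬s.Holds fun _ _ => False) (χ : Formula V) : Provable C ({χ} ▷ {χ}) := by
  -- Every variable becomes `χ`, and the copies of `χ` kept in the context absorb it by contraction.
  refine of_not_holds hC (σ := fun _ => χ) (fun _ _ Γ Δ hΓ _ h => ?_)
    (fun _ _ Γ Δ _ hΔ h => ?_) hs hn
  · obtain ⟨Γ, rfl⟩ := Multiset.exists_cons_of_mem (Multiset.singleton_le.1 hΓ)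
    exact of_unary hC (.contrL _ _ _) h
  · obtain ⟨Δ, rfl⟩ := Multiset.exists_cons_of_mem (Multiset.singleton_le.1 hΔ)
    exact of_unary hC (.contrR _ _ _) h

/-- A variable that is not false becomes `⊤`, removable on the left; one that is not true becomes
`⊥`, removable on the right. Only the empty sequent remains. -/
theorem of_not_isClassicallyValid (hC : belnapCalculus V ⊆ C) {s : Sequent V}
    (hs : Provable C s) (hn : ¬s.IsClassicallyValid) (t : Sequent V) : Provable C t := by
  classical
  obtain ⟨w, hw⟩ := not_forall.1 hn
  refine weaken hC (Multiset.zero_le _) (Multiset.zero_le _) (of_not_holds hC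
    (σ := fun p => if w p then .top else .bot) (fun p hp Γ Δ _ _ h => ?_)
    (fun p hp Γ Δ _ _ h => ?_) hs hw)
  · rw [if_pos (not_not.1 hp)] at h
    exact of_unary hC (.topL_elim _ _) h
  · rw [if_neg (show ¬w p from hp)] at h
    exact of_unary hC (.botR_elim _ _) h

/-! ### Classical completeness and closure under cut -/

/-- Completeness of the calculus with identity for classical logic. -/
theorem of_isClassicallyValid (hC : belnapCalculus V ⊆ C)
    (hid : ∀ χ : Formula V, Provable C ({χ} ▷ {χ})) (n : ℕ) (Γ Δ : Multiset (Formula V))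
    (hn : (Γ.map Formula.size).sum + (Δ.map Formula.size).sum ≤ n)
    (h : (Γ ▷ Δ).IsClassicallyValid) : Provable C (Γ ▷ Δ) := by
  induction n generalizing Γ Δ with
  | zero =>
    have hΓ : Γ = 0 := by
      refine Multiset.eq_zero_of_forall_notMem fun φ hφ => ?_
      have := Multiset.le_sum_of_mem (Multiset.mem_map_of_mem Formula.size hφ)
      have := φ.size_pos
      omega
    have hΔ : Δ = 0 := by
      refine Multiset.eq_zero_of_forall_notMem fun φ hφ => ?_
      have := Multiset.le_sum_of_mem (Multiset.mem_map_of_mem Formula.size hφ)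
      have := φ.size_pos
      omega
    subst hΓ hΔ
    simpa [Sequent.Holds] using h fun _ => True
  | succ n ih =>
    by_cases hΓ : ∀ φ ∈ Γ, ∃ p, φ = .var p
    · by_cases hΔ : ∀ φ ∈ Δ, ∃ p, φ = .var p
      -- Making exactly the variables of `Γ` true leaves nothing false in `Γ`, so some variable of
      -- `Δ` lies in `Γ`.
      · rcases h fun p => .var p ∈ Γ with ⟨φ, hφ, hs⟩ | ⟨φ, hφ, hs⟩
        · obtain ⟨p, rfl⟩ := hΓ φ hφ
          exact (hs hφ).elim
        · obtain ⟨p, rfl⟩ := hΔ φ hφ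
          exact weaken hC (Multiset.singleton_le.2 hs) (Multiset.singleton_le.2 hφ) (hid _)
      push Not at hΔ
      obtain ⟨φ, hφ, hvar⟩ := hΔ
      obtain ⟨Δ, rfl⟩ := Multiset.exists_cons_of_mem hφ
      have hw := fun w => Sequent.holds_cons_right.1 (h w)
      simp only [Multiset.map_cons, Multiset.sum_cons] at hn
      cases φ with
      | var p => exact (hvar p rfl).elim
      | top => exact of_holds hC (.inr ⟨_, hφ, rfl⟩)
      | bot =>
        refine of_unary hC (.weakR _ _ _) (ih _ _ ?_ fun w => ?_)
        · simp only [Formula.size] at hn ⊢; omega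
        · simpa [Formula.Supports] using hw w
      | neg φ =>
        refine of_unary hC (.negR_intro _ _ _) (ih _ _ ?_ fun w => ?_)
        · simp only [Formula.size, Multiset.map_cons, Multiset.sum_cons] at hn ⊢; omega
        · exact Sequent.holds_cons_left.2 (hw w)
      | and φ ψ =>
        refine of_binary hC (.andR_intro _ _ _ _) (ih _ _ ?_ fun w => ?_) (ih _ _ ?_ fun w => ?_)
        · simp only [Formula.size, Multiset.map_cons, Multiset.sum_cons] at hn ⊢; omega
        · exact Sequent.holds_cons_right.2 ((hw w).imp_left And.left)
        · simp only [Formula.size, Multiset.map_cons, Multiset.sum_cons] at hn ⊢; omega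
        · exact Sequent.holds_cons_right.2 ((hw w).imp_left And.right)
      | or φ ψ =>
        refine of_unary hC (.orR_intro _ _ _ _) (ih _ _ ?_ fun w => ?_)
        · simp only [Formula.size, Multiset.map_cons, Multiset.sum_cons] at hn ⊢; omega
        · simpa [Sequent.holds_cons_right, Formula.Supports, or_assoc] using hw w
    · push Not at hΓ
      obtain ⟨φ, hφ, hvar⟩ := hΓ
      obtain ⟨Γ, rfl⟩ := Multiset.exists_cons_of_mem hφ
      have hw := fun w => Sequent.holds_cons_left.1 (h w)
      simp only [Multiset.map_cons, Multiset.sum_cons] at hn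
      cases φ with
      | var p => exact (hvar p rfl).elim
      | top =>
        refine of_unary hC (.weakL _ _ _) (ih _ _ ?_ fun w => ?_)
        · simp only [Formula.size] at hn ⊢; omega
        · simpa [Formula.Supports] using hw w
      | bot => exact of_holds hC (.inl ⟨_, hφ, rfl⟩)
      | neg φ =>
        refine of_unary hC (.negL_intro _ _ _) (ih _ _ ?_ fun w => ?_)
        · simp only [Formula.size, Multiset.map_cons, Multiset.sum_cons] at hn ⊢; omega
        · exact Sequent.holds_cons_right.2 (hw w)
      | and φ ψ =>
        refine of_unary hC (.andL_intro _ _ _ _) (ih _ _ ?_ fun w => ?_)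
        · simp only [Formula.size, Multiset.map_cons, Multiset.sum_cons] at hn ⊢; omega
        · simpa [Sequent.holds_cons_left, Formula.Supports, or_assoc] using hw w
      | or φ ψ =>
        refine of_binary hC (.orL_intro _ _ _ _) (ih _ _ ?_ fun w => ?_) (ih _ _ ?_ fun w => ?_)
        · simp only [Formula.size, Multiset.map_cons, Multiset.sum_cons] at hn ⊢; omega
        · exact Sequent.holds_cons_left.2 ((hw w).imp_left And.left)
        · simp only [Formula.size, Multiset.map_cons, Multiset.sum_cons] at hn ⊢; omega
        · exact Sequent.holds_cons_left.2 ((hw w).imp_left And.right)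

/-- Provability in an extension of the Belnap calculus is closed under cut. -/
theorem cut (hC : belnapCalculus V ⊆ C) {Γ' Δ' : Multiset (Formula V)} {φ : Formula V}
    (h : Provable C (Γ ▷ φ ::ₘ Δ)) (h' : Provable C (φ ::ₘ Γ' ▷ Δ')) :
    Provable C (Γ + Γ' ▷ Δ + Δ') := by
  by_cases hk : (Γ ▷ φ ::ₘ Δ).Holds (fun _ _ => False) ∧ (φ ::ₘ Γ' ▷ Δ').Holds (fun _ _ => False)
  · exact of_holds hC (hk.1.cut (by simp) hk.2)
  have hid : ∀ χ, Provable C ({χ} ▷ {χ}) := by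
    rcases not_and_or.1 hk with hk | hk
    · exact identity_of_not_holds hC h hk
    · exact identity_of_not_holds hC h' hk
  by_cases hv : (Γ ▷ φ ::ₘ Δ).IsClassicallyValid
  · by_cases hv' : (φ ::ₘ Γ' ▷ Δ').IsClassicallyValid
    · exact of_isClassicallyValid hC hid _ _ _ le_rfl (hv.cut hv')
    · exact of_not_isClassicallyValid hC h' hv' _
  · exact of_not_isClassicallyValid hC h hv _

end Provable

theorem mainTheorem6 {V : Type u} (C : GentzenCalculus V) (hC : IsSuperBelnapCalculus C) :
    IsAdmissible (cutRule V) C := by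
  obtain ⟨R, -, rfl⟩ := hC
  have hC : belnapCalculus V ⊆ belnapCalculus V ∪ R := Set.subset_union_left
  intro s hs
  induction hs with
  | prem s hs => exact hs.elim
  | step r hr σ _ ih =>
    rcases hr with hr | ⟨Γ, Γ', Δ, Δ', φ, rfl⟩
    · exact .step r hr σ ih
    have h := ih _ (Set.mem_insert _ _)
    have h' := ih _ (Set.mem_insert_of_mem _ rfl)
    -- A substitution instance of a cut is again a cut.
    simp only [Sequent.subst, Multiset.map_cons, Multiset.map_add] at h h' ⊢
    exact Provable.cut hC h h'
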